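/- Let $U\subset\mathbb R^2$ and $V\subset\mathbb R$ be open sets, let $\alpha:V\to\mathbb R$ be smooth and nowhere zero, let $A=\int\alpha$ be a primitive of $\alpha$ on $V$ (so $A'=\alpha$), and let $\beta$ be the function on $V$ with $\beta\alpha=e^{A}$. Let $h:U\to(0,\infty)$ be smooth, let $g_\Sigma=h^2(dx^2+dy^2)$ and let $\omega_\Sigma=h^2\,dx\wedge dy$ be its area form. Let $l_2,n_2:U\to\mathbb R$ be smooth functions with $d(l_2\,dx+n_2\,dy)=\omega_\Sigma$. On $M=U\times V\times\mathbb R$, with coordinates $(x,y,z,t)$, put $$\theta_3=\tfrac1{\beta(z)}\bigl(dt-l_2(x,y)\,dx-n_2(x,y)\,dy\bigr),\qquad \theta_4=dz,$$ $$g=e^{-A(z)}g_\Sigma+\theta_3\otimes\theta_3+\theta_4\otimes\theta_4 .$$ The Kähler form of a Hermitian structure $J$ (an integrable almost complex structure orthogonal with respect to the metric $g$) is $\Omega(X,Y)=g(JX,Y)$, and $(g,J)$ is Kähler if $d\Omega=0$. The Lee form of $(M,g,J)$ is the 1-form $\theta$ with $d\Omega=2\,\theta\wedge\Omega$. The structure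 $(g,J)$ is locally conformally Kähler if every point has a neighbourhood on which some metric $e^{\varphi}g$, with $\varphi$ a smooth function, is Kähler with respect to $J$. Then $g$ is a Riemannian metric on $M$ and: 1. $(M,g)$ admits a Kähler structure $\bar J$ with Kähler form $\bar\Omega=e^{-A}\omega_\Sigma+\theta_4\wedge\theta_3$. 2. $(M,g)$ admits a Hermitian structure $J$ with Kähler form $\Omega=e^{-A}\omega_\Sigma+\theta_3\wedge\theta_4$. The Ricci tensor $\rho$ of $(M,g)$ is $J$-invariant, i.e. $\rho(JX,JY)=\rho(X,Y)$; $(M,g,J)$ is locally conformally Kähler; and its Lee form is $\theta=-\alpha\,\theta_4$. 3. The scalar curvature of $(M,g)$ is $$\tau=2\left(-\frac{(\Delta\ln h)\,e^{A}}{h^2}-2\alpha^2+2\alpha'+\frac{\beta''}{\beta}-2\Bigl(\frac{\beta'}{\beta}\Bigr)^2\right),\qquad \Delta=\partial_x^2+\partial_y^2 ,$$ where $'$ denotes $d/dz$. -/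

import Mathlib

open scoped ContDiff

noncomputable section

namespace Calabi

/-- The coordinate space `ℝⁿ`. Manifolds below are open subsets of it, with one global chart. -/
abbrev Coord (n : ℕ) : Type := Fin n → ℝ

/-! ### Differential forms on open subsets of `ℝⁿ` -/

/-- Values of differential `k`-forms at a point. -/
abbrev Form (n k : ℕ) : Type := Coord n [⋀^Fin k]→L[ℝ] ℝ

/-- The coordinate covector `dxᵢ`. -/
def dcoord {n : ℕ} (i : Fin n) : Coord n →L[ℝ] ℝ := ContinuousLinearMap.proj i

/-- A covector, as an alternating form of degree one. -/
def asForm {n : ℕ} (a : Coord n →L[ℝ] ℝ) : Form n 1 :=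
  ContinuousAlternatingMap.ofSubsingleton ℝ (Coord n) ℝ (0 : Fin 1) a

/-- The wedge product `a ∧ η` of a covector with a `k`-form:
`(a ∧ η)(v₀, …, v_k) = ∑ᵢ (-1)ⁱ a(vᵢ) η(v₀, …, v̂ᵢ, …, v_k)`. -/
def wedge {n k : ℕ} (a : Coord n →L[ℝ] ℝ) (η : Form n k) : Form n (k + 1) :=
  ContinuousAlternatingMap.alternatizeUncurryFin (a.smulRight η)

/-- The wedge product `a ∧ b` of two covectors, `(a ∧ b)(v, w) = a(v) b(w) - a(w) b(v)`. -/
def wedgeOne {n : ℕ} (a b : Coord n →L[ℝ] ℝ) : Form n 2 := wedge a (asForm b)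

/-! ### Riemannian metrics and their curvature in a chart -/

/-- Fields of bilinear forms on `ℝⁿ`. -/
abbrev BilinField (n : ℕ) : Type := Coord n → Coord n →L[ℝ] Coord n →L[ℝ] ℝ

/-- The tensor product `a ⊗ b` of covectors, `(a ⊗ b)(X, Y) = a(X) b(Y)`. -/
def tensor {n : ℕ} (a b : Coord n →L[ℝ] ℝ) : Coord n →L[ℝ] Coord n →L[ℝ] ℝ := a.smulRight b

/-- `g` is a (smooth) Riemannian metric on the open set `M`. -/
structure IsRiemannianMetricOn {n : ℕ} (g : BilinField n) (M : Set (Coord n)) : Prop where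
  smooth : ContDiffOn ℝ ∞ g M
  symm : ∀ p ∈ M, ∀ X Y, g p X Y = g p Y X
  pos : ∀ p ∈ M, ∀ X, X ≠ 0 → 0 < g p X X

/-- The partial derivative `∂ᵢ F`. -/
def pd {n : ℕ} (i : Fin n) (F : Coord n → ℝ) (p : Coord n) : ℝ :=
  fderiv ℝ F p (Pi.single i 1)

/-- The coordinate components `gᵢⱼ = g(∂ᵢ, ∂ⱼ)`. -/
def metricMatrix {n : ℕ} (g : BilinField n) (p : Coord n) : Matrix (Fin n) (Fin n) ℝ :=
  Matrix.of fun i j => g p (Pi.single i 1) (Pi.single j 1)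

/-- The Christoffel symbols of the Levi-Civita connection, `∇_{∂ᵢ} ∂ⱼ = ∑ₖ Γᵏᵢⱼ ∂ₖ`, where
`Γᵏᵢⱼ = ½ ∑ₗ gᵏˡ (∂ᵢ gⱼₗ + ∂ⱼ gᵢₗ - ∂ₗ gᵢⱼ)`. -/
def christoffel {n : ℕ} (g : BilinField n) (k i j : Fin n) (p : Coord n) : ℝ :=
  (1 / 2) * ∑ l, (metricMatrix g p)⁻¹ k l *
    (pd i (fun q => metricMatrix g q j l) p + pd j (fun q => metricMatrix g q i l) p
      - pd l (fun q => metricMatrix g q i j) p)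

/-- The components of the curvature tensor `R(X,Y)Z = ∇_X ∇_Y Z - ∇_Y ∇_X Z - ∇_{[X,Y]} Z`:
`R(∂ᵢ, ∂ⱼ) ∂ₖ = ∑ₗ Rˡₖᵢⱼ ∂ₗ`. -/
def riemann {n : ℕ} (g : BilinField n) (l k i j : Fin n) (p : Coord n) : ℝ :=
  pd i (christoffel g l j k) p - pd j (christoffel g l i k) p
    + ∑ m, (christoffel g l i m p * christoffel g m j k p
      - christoffel g l j m p * christoffel g m i k p)

/-- The components of the Ricci tensor `ρ(Y, Z) = tr (X ↦ R(X, Y) Z)`. -/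
def ricciComp {n : ℕ} (g : BilinField n) (j k : Fin n) (p : Coord n) : ℝ :=
  ∑ i, riemann g i k i j p

/-- The Ricci tensor. -/
def ricci {n : ℕ} (g : BilinField n) (p X Y : Coord n) : ℝ :=
  ∑ j, ∑ k, X j * Y k * ricciComp g j k p

/-- The scalar curvature `τ = tr_g ρ`. -/
def scalarCurvature {n : ℕ} (g : BilinField n) (p : Coord n) : ℝ :=
  ∑ j, ∑ k, (metricMatrix g p)⁻¹ j k * ricciComp g j k p

/-- The coordinate Laplacian `ΔF = ∑ᵢ ∂ᵢ∂ᵢ F`. -/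
def laplacian {n : ℕ} (F : Coord n → ℝ) (q : Coord n) : ℝ := ∑ i, pd i (pd i F) q

/-! ### Hermitian geometry -/

/-- Fields of endomorphisms of the tangent spaces. -/
abbrev EndField (n : ℕ) : Type := Coord n → Coord n →L[ℝ] Coord n

/-- The Nijenhuis tensor `N(X,Y) = [JX,JY] - J[JX,Y] - J[X,JY] - [X,Y]` of vector fields. -/
def nijenhuis {n : ℕ} (J : EndField n) (X Y : Coord n → Coord n) (p : Coord n) : Coord n :=
  VectorField.lieBracket ℝ (fun q => J q (X q)) (fun q => J q (Y q)) p
    - J p (VectorField.lieBracket ℝ (fun q => J q (X q)) Y p)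
    - J p (VectorField.lieBracket ℝ X (fun q => J q (Y q)) p)
    - VectorField.lieBracket ℝ X Y p

/-- `(M, g, J)` is a Hermitian manifold: `g` is a Riemannian metric and `J` is an integrable
almost complex structure orthogonal with respect to `g`. -/
structure IsHermitianOn {n : ℕ} (g : BilinField n) (J : EndField n) (M : Set (Coord n)) :
    Prop where
  metric : IsRiemannianMetricOn g M
  smooth : ContDiffOn ℝ ∞ J M
  sq : ∀ p ∈ M, ∀ X, J p (J p X) = -X
  orthogonal : ∀ p ∈ M, ∀ X Y, g p (J p X) (J p Y) = g p X Y
  integrable : ∀ X Y : Coord n → Coord n, ContDiffOn ℝ ∞ X M → ContDiffOn ℝ ∞ Y M →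
    ∀ p ∈ M, nijenhuis J X Y p = 0

/-- `Ω` is the Kähler form of `(M, g, J)`: `Ω(X, Y) = g(JX, Y)`. -/
def IsKahlerFormOn {n : ℕ} (g : BilinField n) (J : EndField n) (Ω : Coord n → Form n 2)
    (M : Set (Coord n)) : Prop :=
  ∀ p ∈ M, ∀ X Y, Ω p ![X, Y] = g p (J p X) Y

/-- `(M, g, J)` is a Kähler manifold: it is Hermitian and its Kähler form is closed. -/
def IsKahlerOn {n : ℕ} (g : BilinField n) (J : EndField n) (M : Set (Coord n)) : Prop :=
  IsHermitianOn g J M ∧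
    ∃ Ω : Coord n → Form n 2, IsKahlerFormOn g J Ω M ∧ ∀ p ∈ M, extDeriv Ω p = 0

/-- The Hermitian manifold `(M, g, J)` is locally conformally Kähler: near every point there is a
metric `e^φ g` conformal to `g` which is Kähler with respect to `J`. -/
def IsLocallyConformallyKahlerOn {n : ℕ} (g : BilinField n) (J : EndField n)
    (M : Set (Coord n)) : Prop :=
  IsHermitianOn g J M ∧ ∀ p ∈ M, ∃ W : Set (Coord n), IsOpen W ∧ p ∈ W ∧ W ⊆ M ∧
    ∃ φ : Coord n → ℝ, ContDiffOn ℝ ∞ φ W ∧ IsKahlerOn (fun q => Real.exp (φ q) • g q) J W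

/-- The 1-form `θ` is a Lee form of `(M, g, J)`: `dΩ = 2 θ ∧ Ω` for the Kähler form `Ω`. -/
def IsLeeFormOn {n : ℕ} (g : BilinField n) (J : EndField n) (θ : Coord n → Coord n →L[ℝ] ℝ)
    (M : Set (Coord n)) : Prop :=
  ContDiffOn ℝ ∞ θ M ∧ ∃ Ω : Coord n → Form n 2, IsKahlerFormOn g J Ω M ∧
    ∀ p ∈ M, extDeriv Ω p = (2 : ℝ) • wedge (θ p) (Ω p)

/-- The Ricci tensor of `(M, g)` is `J`-invariant: `ρ(JX, JY) = ρ(X, Y)`. -/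
def HasInvariantRicciOn {n : ℕ} (g : BilinField n) (J : EndField n) (M : Set (Coord n)) : Prop :=
  ∀ p ∈ M, ∀ X Y, ricci g p (J p X) (J p Y) = ricci g p X Y

/-! ### The construction. Coordinates: `(x, y, z, t) = (p 0, p 1, p 2, p 3)` -/

/-- The point `(x, y)` below `(x, y, z, t)`. -/
def base (p : Coord 4) : Coord 2 := ![p 0, p 1]

/-- `M = U × V × ℝ`. -/
def domain (U : Set (Coord 2)) (V : Set ℝ) : Set (Coord 4) := {p | base p ∈ U ∧ p 2 ∈ V}

/-- The 1-form `l₂ dx + n₂ dy` on the base. -/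
def connectionForm (l₂ n₂ : Coord 2 → ℝ) (q : Coord 2) : Coord 2 →L[ℝ] ℝ :=
  l₂ q • dcoord 0 + n₂ q • dcoord 1

/-- The area form `ω_Σ = h² dx ∧ dy` of `g_Σ` on the base. -/
def areaForm (h : Coord 2 → ℝ) (q : Coord 2) : Form 2 2 :=
  (h q) ^ 2 • wedgeOne (dcoord 0) (dcoord 1)

/-- The pullback of `ω_Σ` to `M`. -/
def omegaSigma (h : Coord 2 → ℝ) (p : Coord 4) : Form 4 2 :=
  (h (base p)) ^ 2 • wedgeOne (dcoord 0) (dcoord 1)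

/-- The pullback to `M` of `g_Σ = h² (dx² + dy²)`. -/
def gSigma (h : Coord 2 → ℝ) : BilinField 4 := fun p =>
  (h (base p)) ^ 2 • (tensor (dcoord 0) (dcoord 0) + tensor (dcoord 1) (dcoord 1))

/-- `θ₃ = (1/β) (dt - l₂ dx - n₂ dy)`. -/
def theta3 (β : ℝ → ℝ) (l₂ n₂ : Coord 2 → ℝ) (p : Coord 4) : Coord 4 →L[ℝ] ℝ :=
  (1 / β (p 2)) • (dcoord 3 - l₂ (base p) • dcoord 0 - n₂ (base p) • dcoord 1)

/-- `θ₄ = dz`. -/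
def theta4 (_p : Coord 4) : Coord 4 →L[ℝ] ℝ := dcoord 2

/-- `g = e^{-A} g_Σ + θ₃² + θ₄²`. -/
def calabiMetric (A β : ℝ → ℝ) (h l₂ n₂ : Coord 2 → ℝ) : BilinField 4 := fun p =>
  Real.exp (-A (p 2)) • gSigma h p + tensor (theta3 β l₂ n₂ p) (theta3 β l₂ n₂ p)
    + tensor (theta4 p) (theta4 p)

/-- `Ω̄ = e^{-A} ω_Σ + θ₄ ∧ θ₃`. -/
def omegaBar (A β : ℝ → ℝ) (h l₂ n₂ : Coord 2 → ℝ) (p : Coord 4) : Form 4 2 :=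
  Real.exp (-A (p 2)) • omegaSigma h p + wedgeOne (theta4 p) (theta3 β l₂ n₂ p)

/-- `Ω = e^{-A} ω_Σ + θ₃ ∧ θ₄`. -/
def omega (A β : ℝ → ℝ) (h l₂ n₂ : Coord 2 → ℝ) (p : Coord 4) : Form 4 2 :=
  Real.exp (-A (p 2)) • omegaSigma h p + wedgeOne (theta3 β l₂ n₂ p) (theta4 p)

end Calabi

end

noncomputable section

namespace Calabi

/-! ### Partial derivatives -/

/-! The relation `βα = e^A` gives `1/β = α e^{-A}`, so the metric is `E H (dx² + dy²) + (αE)² (dt -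
l dx - n dy)² + dz²` with `E = e^{-A}` and `H = h²`.

Curvature. Let `μ = α'/α - α`, the logarithmic derivative of `αE = 1/β`, and let `P`, `Q` be the
partial derivatives of `ln h`. Then `E' = -αE`, `α' = αμ + α²`, `H_x = 2PH`, `H_y = 2QH`, and the
condition on `d(l dx + n dy)` reads `n_x = l_y + H`. Differentiation thus becomes formal in a ring
generated by these functions and a few of their derivatives. In it the Christoffel symbols are
polynomials (`CalabiData.christoffel_eq`), and so is the Ricci tensor (`CalabiData.ricciComp_eq`).
The outcome is that Ricci is a multiple of `dx² + dy²` plus a multiple of `θ₃² + θ₄²`. It is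
therefore invariant under every orthogonal `J` preserving the two planes, and its trace is twice the
sum of the two eigenvalues; the stated formula follows from `β' = -μβ` and `β'' = (μ² - μ')β`.

Complex structures. Both are treated together through a sign `ε = ±1`: `J` is the rotation of the
base plane combined with `θ₄ ∘ J = εθ₃`, with form `Ω_ε = E ω_Σ + ε θ₃ ∧ θ₄`. Since `dθ₃ = μ θ₄ ∧ θ₃
- αE ω_Σ`, each summand of `Ω_ε` contributes a multiple of `α θ₄ ∧ E ω_Σ`, and `dΩ_ε = -(1 + ε) α θ₄
∧ Ω_ε`. For `ε = -1` the form is closed. For `ε = 1` the Lee form is `-α θ₄ = -dA`, so `e^{2A} g` is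
Kähler; the Lee form is unique because wedging with `Ω_1` is injective on covectors. -/

/-- `f` is differentiable at `p`, and its partial derivatives there are the entries of `v`. -/
def HasPartials {n : ℕ} (f : Coord n → ℝ) (v : Fin n → ℝ) (p : Coord n) : Prop :=
  DifferentiableAt ℝ f p ∧ ∀ i, pd i f p = v i

section Partials

variable {n : ℕ} {f g : Coord n → ℝ} {p : Coord n} (i : Fin n)

theorem pd_const (c : ℝ) : pd i (fun _ => c) p = 0 := by
  simp [pd]

theorem pd_neg : pd i (fun q => -f q) p = -pd i f p := by
  simp [pd]

theorem pd_add (hf : DifferentiableAt ℝ f p) (hg : DifferentiableAt ℝ g p) :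
    pd i (fun q => f q + g q) p = pd i f p + pd i g p := by
  simp [pd, fderiv_fun_add hf hg]

theorem pd_sub (hf : DifferentiableAt ℝ f p) (hg : DifferentiableAt ℝ g p) :
    pd i (fun q => f q - g q) p = pd i f p - pd i g p := by
  simp [pd, fderiv_fun_sub hf hg]

theorem pd_mul (hf : DifferentiableAt ℝ f p) (hg : DifferentiableAt ℝ g p) :
    pd i (fun q => f q * g q) p = f p * pd i g p + g p * pd i f p := by
  simp [pd, fderiv_fun_mul hf hg]

theorem pd_pow (m : ℕ) (hf : DifferentiableAt ℝ f p) :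
    pd i (fun q => f q ^ m) p = m * f p ^ (m - 1) * pd i f p := by
  simp [pd, fderiv_fun_pow m hf]

theorem pd_div_const (c : ℝ) (hf : DifferentiableAt ℝ f p) :
    pd i (fun q => f q / c) p = pd i f p / c := by
  simp only [div_eq_mul_inv]
  rw [pd_mul i hf (by fun_prop), pd_const]
  ring

theorem _root_.Filter.EventuallyEq.pd_eq (h : f =ᶠ[nhds p] g) : pd i f p = pd i g p := by
  rw [pd, h.fderiv_eq, pd]

end Partials

/-! ### The metric in terms of a differential polynomial ring -/

/-- Functions on an open set `M` of `ℝ⁴` whose partial derivatives are those of the functions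
from which the metric `E H (dx² + dy²) + (α E)² (dt - l dx - n dy)² + dz²` is built. -/
structure CalabiData (M : Set (Coord 4)) where
  (E H α μ P Q l n lx ly ny μz Px Py Qy lxx lxy lyy nyy : Coord 4 → ℝ)
  isOpen : IsOpen M
  E_ne : ∀ p ∈ M, E p ≠ 0
  H_ne : ∀ p ∈ M, H p ≠ 0
  α_ne : ∀ p ∈ M, α p ≠ 0
  partials_E : ∀ p ∈ M, HasPartials E ![0, 0, -(α p * E p), 0] p
  partials_H : ∀ p ∈ M, HasPartials H ![2 * P p * H p, 2 * Q p * H p, 0, 0] p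
  partials_α : ∀ p ∈ M, HasPartials α ![0, 0, α p * μ p + α p ^ 2, 0] p
  partials_μ : ∀ p ∈ M, HasPartials μ ![0, 0, μz p, 0] p
  partials_P : ∀ p ∈ M, HasPartials P ![Px p, Py p, 0, 0] p
  partials_Q : ∀ p ∈ M, HasPartials Q ![Py p, Qy p, 0, 0] p
  partials_l : ∀ p ∈ M, HasPartials l ![lx p, ly p, 0, 0] p
  partials_n : ∀ p ∈ M, HasPartials n ![ly p + H p, ny p, 0, 0] p
  partials_lx : ∀ p ∈ M, HasPartials lx ![lxx p, lxy p, 0, 0] p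
  partials_ly : ∀ p ∈ M, HasPartials ly ![lxy p, lyy p, 0, 0] p
  partials_ny : ∀ p ∈ M, HasPartials ny ![lyy p + 2 * Q p * H p, nyy p, 0, 0] p

namespace CalabiData

variable {M : Set (Coord 4)}

/-- The components of the metric. -/
def metric (D : CalabiData M) (p : Coord 4) : Matrix (Fin 4) (Fin 4) ℝ :=
  !![D.E p * D.H p + D.α p ^ 2 * D.E p ^ 2 * D.l p ^ 2, D.α p ^ 2 * D.E p ^ 2 * D.l p * D.n p, 0,
      -(D.α p ^ 2 * D.E p ^ 2 * D.l p);
    D.α p ^ 2 * D.E p ^ 2 * D.l p * D.n p, D.E p * D.H p + D.α p ^ 2 * D.E p ^ 2 * D.n p ^ 2, 0,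
      -(D.α p ^ 2 * D.E p ^ 2 * D.n p);
    0, 0, 1, 0;
    -(D.α p ^ 2 * D.E p ^ 2 * D.l p), -(D.α p ^ 2 * D.E p ^ 2 * D.n p), 0, D.α p ^ 2 * D.E p ^ 2]

/-- The components of the inverse of the metric. -/
def inverseMetric (D : CalabiData M) (p : Coord 4) : Matrix (Fin 4) (Fin 4) ℝ :=
  !![1 / (D.E p * D.H p), 0, 0, D.l p / (D.E p * D.H p);
    0, 1 / (D.E p * D.H p), 0, D.n p / (D.E p * D.H p);
    0, 0, 1, 0;
    D.l p / (D.E p * D.H p), D.n p / (D.E p * D.H p), 0,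
      (D.l p ^ 2 + D.n p ^ 2) / (D.E p * D.H p) + 1 / (D.α p ^ 2 * D.E p ^ 2)]

/-- In the orthogonal frame `∂x + l ∂t`, `∂y + n ∂t`, `∂z`, `∂t` the squared lengths are `EH`, `EH`,
`1`, `α²E²`; summing the squares of the frame vectors divided by these gives the inverse. -/
theorem inv_metric (D : CalabiData M) {p : Coord 4} (hp : p ∈ M) :
    (D.metric p)⁻¹ = D.inverseMetric p := by
  have hE := D.E_ne p hp
  have hH := D.H_ne p hp
  have hα := D.α_ne p hp
  refine Matrix.inv_eq_right_inv ?_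
  ext i j
  fin_cases i <;> fin_cases j <;>
    simp [metric, inverseMetric, Matrix.mul_apply, Fin.sum_univ_four] <;> field_simp <;> ring

/-- The partial derivatives of the components of the metric. -/
def partialMetric (D : CalabiData M) (p : Coord 4) : Fin 4 → Matrix (Fin 4) (Fin 4) ℝ
  | 0 => !![2 * D.E p ^ 2 * D.α p ^ 2 * D.l p * D.lx p + 2 * D.E p * D.H p * D.P p, D.E p ^ 2 * D.H p * D.α p ^ 2 * D.l p + D.E p ^ 2 * D.α p ^ 2 * D.l p * D.ly p + D.E p ^ 2 * D.α p ^ 2 * D.n p * D.lx p, 0, -D.E p ^ 2 * D.α p ^ 2 * D.lx p;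
      D.E p ^ 2 * D.H p * D.α p ^ 2 * D.l p + D.E p ^ 2 * D.α p ^ 2 * D.l p * D.ly p + D.E p ^ 2 * D.α p ^ 2 * D.n p * D.lx p, 2 * D.E p ^ 2 * D.H p * D.α p ^ 2 * D.n p + 2 * D.E p ^ 2 * D.α p ^ 2 * D.n p * D.ly p + 2 * D.E p * D.H p * D.P p, 0, -D.E p ^ 2 * D.H p * D.α p ^ 2 - D.E p ^ 2 * D.α p ^ 2 * D.ly p;
      0, 0, 0, 0;
      -D.E p ^ 2 * D.α p ^ 2 * D.lx p, -D.E p ^ 2 * D.H p * D.α p ^ 2 - D.E p ^ 2 * D.α p ^ 2 * D.ly p, 0, 0]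
  | 1 => !![2 * D.E p ^ 2 * D.α p ^ 2 * D.l p * D.ly p + 2 * D.E p * D.H p * D.Q p, D.E p ^ 2 * D.α p ^ 2 * D.l p * D.ny p + D.E p ^ 2 * D.α p ^ 2 * D.n p * D.ly p, 0, -D.E p ^ 2 * D.α p ^ 2 * D.ly p;
      D.E p ^ 2 * D.α p ^ 2 * D.l p * D.ny p + D.E p ^ 2 * D.α p ^ 2 * D.n p * D.ly p, 2 * D.E p ^ 2 * D.α p ^ 2 * D.n p * D.ny p + 2 * D.E p * D.H p * D.Q p, 0, -D.E p ^ 2 * D.α p ^ 2 * D.ny p;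
      0, 0, 0, 0;
      -D.E p ^ 2 * D.α p ^ 2 * D.ly p, -D.E p ^ 2 * D.α p ^ 2 * D.ny p, 0, 0]
  | 2 => !![2 * D.E p ^ 2 * D.α p ^ 2 * D.μ p * D.l p ^ 2 - D.E p * D.H p * D.α p, 2 * D.E p ^ 2 * D.α p ^ 2 * D.μ p * D.l p * D.n p, 0, -2 * D.E p ^ 2 * D.α p ^ 2 * D.μ p * D.l p;
      2 * D.E p ^ 2 * D.α p ^ 2 * D.μ p * D.l p * D.n p, 2 * D.E p ^ 2 * D.α p ^ 2 * D.μ p * D.n p ^ 2 - D.E p * D.H p * D.α p, 0, -2 * D.E p ^ 2 * D.α p ^ 2 * D.μ p * D.n p;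
      0, 0, 0, 0;
      -2 * D.E p ^ 2 * D.α p ^ 2 * D.μ p * D.l p, -2 * D.E p ^ 2 * D.α p ^ 2 * D.μ p * D.n p, 0, 2 * D.E p ^ 2 * D.α p ^ 2 * D.μ p]
  | 3 => 0

/-- The Christoffel symbols of the metric: the entry `i j` of the matrix `k` is `Γᵏᵢⱼ`. -/
def christoffelMatrix (D : CalabiData M) (p : Coord 4) : Fin 4 → Matrix (Fin 4) (Fin 4) ℝ
  | 0 => !![D.P p, -D.E p * D.α p ^ 2 * D.l p / 2 + D.Q p, -D.α p / 2, 0;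
      -D.E p * D.α p ^ 2 * D.l p / 2 + D.Q p, -D.E p * D.α p ^ 2 * D.n p - D.P p, 0, D.E p * D.α p ^ 2 / 2;
      -D.α p / 2, 0, 0, 0;
      0, D.E p * D.α p ^ 2 / 2, 0, 0]
  | 1 => !![D.E p * D.α p ^ 2 * D.l p - D.Q p, D.E p * D.α p ^ 2 * D.n p / 2 + D.P p, 0, -D.E p * D.α p ^ 2 / 2;
      D.E p * D.α p ^ 2 * D.n p / 2 + D.P p, D.Q p, -D.α p / 2, 0;
      0, -D.α p / 2, 0, 0;
      -D.E p * D.α p ^ 2 / 2, 0, 0, 0]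
  | 2 => !![-D.E p ^ 2 * D.α p ^ 2 * D.μ p * D.l p ^ 2 + D.E p * D.H p * D.α p / 2, -D.E p ^ 2 * D.α p ^ 2 * D.μ p * D.l p * D.n p, 0, D.E p ^ 2 * D.α p ^ 2 * D.μ p * D.l p;
      -D.E p ^ 2 * D.α p ^ 2 * D.μ p * D.l p * D.n p, -D.E p ^ 2 * D.α p ^ 2 * D.μ p * D.n p ^ 2 + D.E p * D.H p * D.α p / 2, 0, D.E p ^ 2 * D.α p ^ 2 * D.μ p * D.n p;
      0, 0, 0, 0;
      D.E p ^ 2 * D.α p ^ 2 * D.μ p * D.l p, D.E p ^ 2 * D.α p ^ 2 * D.μ p * D.n p, 0, -D.E p ^ 2 * D.α p ^ 2 * D.μ p]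
  | 3 => !![D.E p * D.α p ^ 2 * D.l p * D.n p + D.P p * D.l p - D.Q p * D.n p - D.lx p, -D.E p * D.α p ^ 2 * D.l p ^ 2 / 2 + D.E p * D.α p ^ 2 * D.n p ^ 2 / 2 - D.H p / 2 + D.P p * D.n p + D.Q p * D.l p - D.ly p, -D.α p * D.l p / 2 - D.μ p * D.l p, -D.E p * D.α p ^ 2 * D.n p / 2;
      -D.E p * D.α p ^ 2 * D.l p ^ 2 / 2 + D.E p * D.α p ^ 2 * D.n p ^ 2 / 2 - D.H p / 2 + D.P p * D.n p + D.Q p * D.l p - D.ly p, -D.E p * D.α p ^ 2 * D.l p * D.n p - D.P p * D.l p + D.Q p * D.n p - D.ny p, -D.α p * D.n p / 2 - D.μ p * D.n p, D.E p * D.α p ^ 2 * D.l p / 2;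
      -D.α p * D.l p / 2 - D.μ p * D.l p, -D.α p * D.n p / 2 - D.μ p * D.n p, 0, D.μ p;
      -D.E p * D.α p ^ 2 * D.n p / 2, D.E p * D.α p ^ 2 * D.l p / 2, D.μ p, 0]

theorem pd_metric (D : CalabiData M) {p : Coord 4} (hp : p ∈ M) (k i j : Fin 4) :
    pd k (fun q => D.metric q i j) p = D.partialMetric p k i j := by
  obtain ⟨dE, hE⟩ := D.partials_E p hp
  obtain ⟨dH, hH⟩ := D.partials_H p hp
  obtain ⟨dα, hα⟩ := D.partials_α p hp
  obtain ⟨dl, hl⟩ := D.partials_l p hp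
  obtain ⟨dn, hn⟩ := D.partials_n p hp
  fin_cases i <;> fin_cases j <;> simp [metric] <;>
    simp (disch := fun_prop (disch := assumption)) only
      [pd_add, pd_mul, pd_pow, pd_neg, pd_const, hE, hH, hα, hl, hn] <;>
    fin_cases k <;>
    simp only [partialMetric, Fin.zero_eta, Fin.mk_one, Fin.reduceFinMk, Fin.isValue,
      Matrix.of_apply, Matrix.cons_val, Matrix.zero_apply] <;> ring

theorem christoffel_eq (D : CalabiData M) {g : BilinField 4}
    (hg : ∀ q ∈ M, metricMatrix g q = D.metric q) {p : Coord 4} (hp : p ∈ M) (k i j : Fin 4) :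
    christoffel g k i j p = D.christoffelMatrix p k i j := by
  have hpd : ∀ k i j, pd k (fun q => metricMatrix g q i j) p = D.partialMetric p k i j := by
    intro k i j
    rw [← D.pd_metric hp]
    -- The components are known only on `M`; openness makes this an equality of germs, which is what
    -- a derivative needs.
    refine Filter.EventuallyEq.pd_eq k ?_
    filter_upwards [D.isOpen.mem_nhds hp] with q hq
    rw [hg q hq]
  simp only [christoffel, hpd, hg p hp, D.inv_metric hp, Fin.sum_univ_four]
  have hE := D.E_ne p hp
  have hH := D.H_ne p hp
  have hα := D.α_ne p hp
  fin_cases k <;> fin_cases i <;> fin_cases j <;>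
    simp only [partialMetric, inverseMetric, christoffelMatrix, Fin.zero_eta, Fin.mk_one,
      Fin.reduceFinMk, Fin.isValue, Matrix.of_apply, Matrix.cons_val, Matrix.zero_apply] <;>
    field_simp <;> ring

/-- The value of the Ricci tensor on the horizontal coordinate vectors `∂x + l ∂t`, `∂y + n ∂t`. -/
def horizontalRicci (D : CalabiData M) (p : Coord 4) : ℝ :=
  -(D.Px p + D.Qy p) + (D.α p * D.μ p - D.α p ^ 2 / 2) * (D.E p * D.H p)

/-- The value of the Ricci tensor on the unit vectors orthogonal to the horizontal ones. -/
def verticalRicci (D : CalabiData M) (p : Coord 4) : ℝ :=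
  -D.μz p - D.μ p ^ 2 + D.α p * D.μ p + D.α p ^ 2 / 2

/-- The components of the Ricci tensor. -/
def ricciMatrix (D : CalabiData M) (p : Coord 4) : Matrix (Fin 4) (Fin 4) ℝ :=
  !![D.horizontalRicci p + D.verticalRicci p * (D.α p ^ 2 * D.E p ^ 2 * D.l p ^ 2),
      D.verticalRicci p * (D.α p ^ 2 * D.E p ^ 2 * D.l p * D.n p), 0,
      -(D.verticalRicci p * (D.α p ^ 2 * D.E p ^ 2 * D.l p));
    D.verticalRicci p * (D.α p ^ 2 * D.E p ^ 2 * D.l p * D.n p),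
      D.horizontalRicci p + D.verticalRicci p * (D.α p ^ 2 * D.E p ^ 2 * D.n p ^ 2), 0,
      -(D.verticalRicci p * (D.α p ^ 2 * D.E p ^ 2 * D.n p));
    0, 0, D.verticalRicci p, 0;
    -(D.verticalRicci p * (D.α p ^ 2 * D.E p ^ 2 * D.l p)),
      -(D.verticalRicci p * (D.α p ^ 2 * D.E p ^ 2 * D.n p)), 0,
      D.verticalRicci p * (D.α p ^ 2 * D.E p ^ 2)]

/-- The denominators of the inverse metric have cancelled in the Christoffel symbols, so each
component is a polynomial identity. The derivatives of `l` and `n` all drop out. -/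
theorem ricciComp_eq (D : CalabiData M) {g : BilinField 4}
    (hg : ∀ q ∈ M, metricMatrix g q = D.metric q) {p : Coord 4} (hp : p ∈ M) (j k : Fin 4) :
    ricciComp g j k p = D.ricciMatrix p j k := by
  have hpd : ∀ m k i j, pd m (christoffel g k i j) p
      = pd m (fun q => D.christoffelMatrix q k i j) p := by
    intro m k i j
    refine Filter.EventuallyEq.pd_eq m ?_
    filter_upwards [D.isOpen.mem_nhds hp] with q hq
    rw [D.christoffel_eq hg hq]
  simp only [ricciComp, riemann, hpd, D.christoffel_eq hg hp, Fin.sum_univ_four]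
  obtain ⟨dE, hE⟩ := D.partials_E p hp
  obtain ⟨dH, hH⟩ := D.partials_H p hp
  obtain ⟨dα, hα⟩ := D.partials_α p hp
  obtain ⟨dμ, hμ⟩ := D.partials_μ p hp
  obtain ⟨dP, hP⟩ := D.partials_P p hp
  obtain ⟨dQ, hQ⟩ := D.partials_Q p hp
  obtain ⟨dl, hl⟩ := D.partials_l p hp
  obtain ⟨dn, hn⟩ := D.partials_n p hp
  obtain ⟨dlx, hlx⟩ := D.partials_lx p hp
  obtain ⟨dly, hly⟩ := D.partials_ly p hp
  obtain ⟨dny, hny⟩ := D.partials_ny p hp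
  fin_cases j <;> fin_cases k <;>
    (simp only [christoffelMatrix, Fin.zero_eta, Fin.mk_one, Fin.reduceFinMk, Fin.isValue,
      Matrix.of_apply, Matrix.cons_val]
     simp (disch := fun_prop (disch := assumption)) only
      [pd_add, pd_sub, pd_mul, pd_pow, pd_neg, pd_div_const, pd_const, hE, hH, hα, hμ, hP, hQ, hl,
        hn, hlx, hly, hny]
     simp only [ricciMatrix, horizontalRicci, verticalRicci, Fin.isValue, Matrix.of_apply,
      Matrix.cons_val]
     ring)

/-- Each of the two orthogonal planes is an eigenspace of Ricci, so each eigenvalue counts twice;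
the horizontal vectors have squared length `EH`. -/
theorem scalarCurvature_eq (D : CalabiData M) {g : BilinField 4}
    (hg : ∀ q ∈ M, metricMatrix g q = D.metric q) {p : Coord 4} (hp : p ∈ M) :
    scalarCurvature g p
      = 2 * (D.horizontalRicci p / (D.E p * D.H p) + D.verticalRicci p) := by
  have hE := D.E_ne p hp
  have hH := D.H_ne p hp
  have hα := D.α_ne p hp
  simp only [scalarCurvature, hg p hp, D.inv_metric hp, D.ricciComp_eq hg hp, Fin.sum_univ_four,
    inverseMetric, ricciMatrix, Fin.isValue, Matrix.of_apply, Matrix.cons_val]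
  field_simp
  ring

end CalabiData

/-! ### Smoothness and symmetry of partial derivatives, and functions pulled back to the total space
-/

section Partials

variable {n : ℕ} {f : Coord n → ℝ} {s : Set (Coord n)} {p : Coord n}

theorem fderiv_apply_eq_sum (f : Coord n → ℝ) (p v : Coord n) :
    fderiv ℝ f p v = ∑ i, v i * pd i f p := by
  conv_lhs => rw [pi_eq_sum_univ' v]
  simp [pd, map_sum, map_smul]

theorem _root_.ContDiffOn.pd (hf : ContDiffOn ℝ ∞ f s) (hs : IsOpen s) (i : Fin n) :
    ContDiffOn ℝ ∞ (pd i f) s :=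
  (hf.fderiv_of_isOpen hs (by simp)).clm_apply contDiffOn_const

theorem pd_comm (hf : ContDiffOn ℝ ∞ f s) (hs : IsOpen s) (hp : p ∈ s) (i j : Fin n) :
    pd i (pd j f) p = pd j (pd i f) p := by
  have hfp : ContDiffAt ℝ ∞ f p := hf.contDiffAt (hs.mem_nhds hp)
  have hd : DifferentiableAt ℝ (fderiv ℝ f) p :=
    (hfp.fderiv_right (m := 1) (by norm_cast)).differentiableAt (by simp)
  have key : ∀ k m : Fin n, pd k (pd m f) p
      = fderiv ℝ (fderiv ℝ f) p (Pi.single k 1) (Pi.single m 1) := by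
    intro k m
    change fderiv ℝ (fun q => fderiv ℝ f q (Pi.single m 1)) p (Pi.single k 1) = _
    rw [fderiv_clm_apply hd (by fun_prop)]
    simp
  rw [key, key]
  exact (hfp.isSymmSndFDerivAt (by simpa using WithTop.coe_le_coe.2 (le_top : (2 : ℕ∞) ≤ ⊤))) _ _

theorem _root_.ContDiffOn.differentiableAt_of_isOpen (hf : ContDiffOn ℝ ∞ f s) (hs : IsOpen s)
    (hp : p ∈ s) : DifferentiableAt ℝ f p :=
  (hf.contDiffAt (hs.mem_nhds hp)).differentiableAt (by simp)

end Partials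

/-- The projection `(x, y, z, t) ↦ (x, y)` as a continuous linear map. -/
def baseCLM : Coord 4 →L[ℝ] Coord 2 :=
  ContinuousLinearMap.pi ![dcoord 0, dcoord 1]

theorem baseCLM_apply (p : Coord 4) : baseCLM p = base p := by
  ext i
  fin_cases i <;> simp [baseCLM, base, dcoord]

theorem contDiff_base : ContDiff ℝ ∞ base := by
  have : base = baseCLM := funext fun p => (baseCLM_apply p).symm
  rw [this]
  exact baseCLM.contDiff

theorem hasPartials_comp_base {f : Coord 2 → ℝ} {p : Coord 4}
    (hf : DifferentiableAt ℝ f (base p)) :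
    HasPartials (fun q => f (base q)) ![pd 0 f (base p), pd 1 f (base p), 0, 0] p := by
  have hb : base = baseCLM := funext fun p => (baseCLM_apply p).symm
  have h : HasFDerivAt (fun q => f (base q)) ((fderiv ℝ f (base p)).comp baseCLM) p := by
    refine HasFDerivAt.comp p hf.hasFDerivAt ?_
    rw [hb]
    exact baseCLM.hasFDerivAt
  refine ⟨h.differentiableAt, fun i => ?_⟩
  rw [pd, h.fderiv, ContinuousLinearMap.comp_apply, baseCLM_apply, fderiv_apply_eq_sum]
  fin_cases i <;> simp [base]

theorem hasPartials_comp_z {f : ℝ → ℝ} {f' : ℝ} {p : Coord 4} (hf : HasDerivAt f f' (p 2)) :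
    HasPartials (fun q => f (q 2)) ![0, 0, f', 0] p := by
  have h : HasFDerivAt (fun q : Coord 4 => f (q 2)) (f' • (dcoord 2 : Coord 4 →L[ℝ] ℝ)) p :=
    HasDerivAt.comp_hasFDerivAt p hf (dcoord 2 : Coord 4 →L[ℝ] ℝ).hasFDerivAt
  refine ⟨h.differentiableAt, fun i => ?_⟩
  rw [pd, h.fderiv]
  fin_cases i <;> simp [dcoord]

theorem HasPartials.congr_right {n : ℕ} {f : Coord n → ℝ} {v w : Fin n → ℝ} {p : Coord n}
    (hf : HasPartials f v p) (h : v = w) : HasPartials f w p :=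
  h ▸ hf

/-! ### Values of wedge products -/

section Wedge

variable {n : ℕ} (a b : Coord n →L[ℝ] ℝ)

theorem asForm_apply (v : Fin 1 → Coord n) : asForm a v = a (v 0) :=
  rfl

theorem wedgeOne_apply (v : Fin 2 → Coord n) :
    wedgeOne a b v = a (v 0) * b (v 1) - a (v 1) * b (v 0) := by
  simp [wedgeOne, wedge, asForm_apply, ContinuousAlternatingMap.alternatizeUncurryFin_apply,
    Fin.sum_univ_two, Fin.removeNth]
  ring

theorem wedge_apply_two (η : Form n 2) (v : Fin 3 → Coord n) :
    wedge a η v = a (v 0) * η ![v 1, v 2] - a (v 1) * η ![v 0, v 2]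
      + a (v 2) * η ![v 0, v 1] := by
  have h0 : Fin.removeNth 0 v = ![v 1, v 2] := by
    ext i; fin_cases i <;> rfl
  have h1 : Fin.removeNth 1 v = ![v 0, v 2] := by
    ext i; fin_cases i <;> rfl
  have h2 : Fin.removeNth 2 v = ![v 0, v 1] := by
    ext i; fin_cases i <;> rfl
  simp [wedge, ContinuousAlternatingMap.alternatizeUncurryFin_apply, Fin.sum_univ_three, h0, h1,
    h2]
  ring

theorem wedge_sub_left {k : ℕ} (η : Form n k) :
    wedge (a - b) η = wedge a η - wedge b η := by
  ext v
  simp [wedge, ContinuousAlternatingMap.alternatizeUncurryFin_apply, sub_mul,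
    mul_sub, Finset.sum_sub_distrib]

theorem wedge_smul_left {k : ℕ} (c : ℝ) (η : Form n k) :
    wedge (c • a) η = c • wedge a η := by
  ext v
  simp [wedge, ContinuousAlternatingMap.alternatizeUncurryFin_apply, Finset.mul_sum]
  exact Finset.sum_congr rfl fun i _ => by ring

theorem extDeriv_smul_const {k : ℕ} {f : Coord n → ℝ} {p : Coord n}
    (hf : DifferentiableAt ℝ f p) (η : Form n k) :
    extDeriv (fun q => f q • η) p = wedge (fderiv ℝ f p) η := by
  rw [extDeriv, (hf.hasFDerivAt.smul_const η).fderiv, wedge]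

end Wedge

/-- A 2-form on the plane is determined by its value on the two coordinate vectors; this is the only
form in which the hypothesis on `l dx + n dy` is used. -/
theorem pd_sub_pd_eq_of_extDeriv {U : Set (Coord 2)} (hU : IsOpen U) {h l n : Coord 2 → ℝ}
    (hl : ContDiffOn ℝ ∞ l U) (hn : ContDiffOn ℝ ∞ n U) {q : Coord 2} (hq : q ∈ U)
    (hd : extDeriv (fun r => asForm (connectionForm l n r)) q = areaForm h q) :
    pd 0 n q = pd 1 l q + h q ^ 2 := by
  have dl := hl.differentiableAt_of_isOpen hU hq
  have dn := hn.differentiableAt_of_isOpen hU hq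
  have hform : (fun r => asForm (connectionForm l n r))
      = fun r => l r • asForm (dcoord 0) + n r • asForm (dcoord 1) := by
    funext r
    ext v
    simp [asForm_apply, connectionForm]
  have h1 := congrArg (fun w => w ![Pi.single 0 1, Pi.single 1 1]) hd
  rw [hform] at h1
  simp only [areaForm] at h1
  rw [extDeriv_fun_add (dl.smul_const _) (dn.smul_const _), extDeriv_smul_const dl,
    extDeriv_smul_const dn] at h1
  change wedgeOne _ _ _ + wedgeOne _ _ _ = _ at h1
  simp [wedgeOne_apply, dcoord] at h1
  simp only [pd]
  linarith

/-- The hypotheses on the functions from which the metric is built. -/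
structure IsCalabiAnsatz (U : Set (Coord 2)) (V : Set ℝ) (α A β : ℝ → ℝ)
    (h l n : Coord 2 → ℝ) : Prop where
  isOpen_base : IsOpen U
  isOpen_fiber : IsOpen V
  smooth_α : ContDiffOn ℝ ∞ α V
  α_ne : ∀ z ∈ V, α z ≠ 0
  hasDerivAt_A : ∀ z ∈ V, HasDerivAt A (α z) z
  β_mul_α : ∀ z ∈ V, β z * α z = Real.exp (A z)
  smooth_h : ContDiffOn ℝ ∞ h U
  h_pos : ∀ q ∈ U, 0 < h q
  smooth_l : ContDiffOn ℝ ∞ l U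
  smooth_n : ContDiffOn ℝ ∞ n U
  curl : ∀ q ∈ U, pd 0 n q = pd 1 l q + h q ^ 2

/-! ### The ansatz as an instance of the formal computation; scalar curvature -/

namespace IsCalabiAnsatz

variable {U : Set (Coord 2)} {V : Set ℝ} {α A β : ℝ → ℝ} {h l n : Coord 2 → ℝ}

theorem isOpen_domain (H : IsCalabiAnsatz U V α A β h l n) : IsOpen (domain U V) :=
  (H.isOpen_base.preimage contDiff_base.continuous).inter
    (H.isOpen_fiber.preimage (continuous_apply 2))

theorem β_ne (H : IsCalabiAnsatz U V α A β h l n) {z : ℝ} (hz : z ∈ V) : β z ≠ 0 := fun h0 =>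
  (Real.exp_pos (A z)).ne' (by rw [← H.β_mul_α z hz, h0, zero_mul])

theorem one_div_β (H : IsCalabiAnsatz U V α A β h l n) {z : ℝ} (hz : z ∈ V) :
    1 / β z = α z * Real.exp (-A z) := by
  have := H.β_ne hz
  have := H.α_ne z hz
  rw [Real.exp_neg, ← H.β_mul_α z hz]
  field_simp

/-- Only differentiability of the primitive is given; smoothness is inherited from `A' = α`. -/
theorem smooth_A (H : IsCalabiAnsatz U V α A β h l n) : ContDiffOn ℝ ∞ A V := by
  refine (contDiffOn_infty_iff_deriv_of_isOpen H.isOpen_fiber).2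
    ⟨fun z hz => (H.hasDerivAt_A z hz).differentiableAt.differentiableWithinAt, ?_⟩
  exact H.smooth_α.congr fun z hz => (H.hasDerivAt_A z hz).deriv

/-- No regularity of `β` is assumed: it is forced by `β = e^A / α` on `V`. -/
theorem smooth_β (H : IsCalabiAnsatz U V α A β h l n) : ContDiffOn ℝ ∞ β V := by
  refine ((H.smooth_A.exp).div H.smooth_α H.α_ne).congr fun z hz => ?_
  rw [Pi.div_apply, ← H.β_mul_α z hz, mul_div_cancel_right₀ _ (H.α_ne z hz)]

theorem smooth_deriv_α (H : IsCalabiAnsatz U V α A β h l n) : ContDiffOn ℝ ∞ (deriv α) V :=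
  ((contDiffOn_infty_iff_deriv_of_isOpen H.isOpen_fiber).1 H.smooth_α).2

theorem smooth_log_h (H : IsCalabiAnsatz U V α A β h l n) :
    ContDiffOn ℝ ∞ (fun q => Real.log (h q)) U :=
  H.smooth_h.log fun q hq => (H.h_pos q hq).ne'

theorem pd_log_h (H : IsCalabiAnsatz U V α A β h l n) {q : Coord 2} (hq : q ∈ U) (i : Fin 2) :
    pd i (fun r => Real.log (h r)) q = pd i h q / h q := by
  have hd := H.smooth_h.differentiableAt_of_isOpen H.isOpen_base hq
  simp only [pd]
  rw [(hd.hasFDerivAt.log (H.h_pos q hq).ne').fderiv]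
  simp [div_eq_inv_mul]

theorem hasDerivAt_α (H : IsCalabiAnsatz U V α A β h l n) {z : ℝ} (hz : z ∈ V) :
    HasDerivAt α (deriv α z) z :=
  ((H.smooth_α.contDiffAt (H.isOpen_fiber.mem_nhds hz)).differentiableAt (by simp)).hasDerivAt

/-- The logarithmic derivative of `1 / β`. -/
def logDerivInv (α : ℝ → ℝ) (z : ℝ) : ℝ := deriv α z / α z - α z

theorem hasDerivAt_logDerivInv (H : IsCalabiAnsatz U V α A β h l n) {z : ℝ} (hz : z ∈ V) :
    HasDerivAt (logDerivInv α) (deriv (logDerivInv α) z) z := by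
  have : ContDiffOn ℝ ∞ (logDerivInv α) V :=
    (H.smooth_deriv_α.div H.smooth_α H.α_ne).sub H.smooth_α
  exact ((this.contDiffAt (H.isOpen_fiber.mem_nhds hz)).differentiableAt (by simp)).hasDerivAt

/-- Logarithmic differentiation of `β = e^A / α` gives `α - α'/α`. -/
theorem hasDerivAt_β (H : IsCalabiAnsatz U V α A β h l n) {z : ℝ} (hz : z ∈ V) :
    HasDerivAt β (-(logDerivInv α z * β z)) z := by
  have hα := H.α_ne z hz
  have key := ((H.hasDerivAt_A z hz).exp.div (H.hasDerivAt_α hz) hα).congr_of_eventuallyEq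
    (f₁ := β) (by
      filter_upwards [H.isOpen_fiber.mem_nhds hz] with w hw
      rw [Pi.div_apply, ← H.β_mul_α w hw, mul_div_cancel_right₀ _ (H.α_ne w hw)])
  refine key.congr_deriv ?_
  rw [← H.β_mul_α z hz, logDerivInv]
  field_simp
  ring

theorem deriv_deriv_β (H : IsCalabiAnsatz U V α A β h l n) {z : ℝ} (hz : z ∈ V) :
    deriv (deriv β) z = (logDerivInv α z ^ 2 - deriv (logDerivInv α) z) * β z := by
  have he : deriv β =ᶠ[nhds z] fun w => -(logDerivInv α w * β w) := by
    filter_upwards [H.isOpen_fiber.mem_nhds hz] with w hw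
    exact (H.hasDerivAt_β hw).deriv
  rw [he.deriv_eq]
  rw [((H.hasDerivAt_logDerivInv hz).fun_mul (H.hasDerivAt_β hz)).fun_neg.deriv]
  ring

/-- The functions of the metric, as functions on the total space. -/
def data (H : IsCalabiAnsatz U V α A β h l n) : CalabiData (domain U V) where
  E p := Real.exp (-A (p 2))
  H p := h (base p) ^ 2
  α p := α (p 2)
  μ p := logDerivInv α (p 2)
  P p := pd 0 (fun q => Real.log (h q)) (base p)
  Q p := pd 1 (fun q => Real.log (h q)) (base p)
  l p := l (base p)
  n p := n (base p)
  lx p := pd 0 l (base p)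
  ly p := pd 1 l (base p)
  ny p := pd 1 n (base p)
  μz p := deriv (logDerivInv α) (p 2)
  Px p := pd 0 (pd 0 fun q => Real.log (h q)) (base p)
  Py p := pd 1 (pd 0 fun q => Real.log (h q)) (base p)
  Qy p := pd 1 (pd 1 fun q => Real.log (h q)) (base p)
  lxx p := pd 0 (pd 0 l) (base p)
  lxy p := pd 1 (pd 0 l) (base p)
  lyy p := pd 1 (pd 1 l) (base p)
  nyy p := pd 1 (pd 1 n) (base p)
  isOpen := H.isOpen_domain
  E_ne p _ := (Real.exp_pos _).ne'
  H_ne p hp := pow_ne_zero 2 (H.h_pos _ hp.1).ne'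
  α_ne p hp := H.α_ne _ hp.2
  partials_E p hp := (hasPartials_comp_z (f := fun z => Real.exp (-A z))
    (H.hasDerivAt_A _ hp.2).fun_neg.exp).congr_right (by
      congr 3
      ring)
  partials_H p hp := by
    have hd := H.smooth_h.differentiableAt_of_isOpen H.isOpen_base hp.1
    refine (hasPartials_comp_base (f := fun q => h q ^ 2) (hd.fun_pow 2)).congr_right ?_
    have := (H.h_pos _ hp.1).ne'
    simp only [pd_pow _ 2 hd, H.pd_log_h hp.1]
    ext i
    fin_cases i <;> simp <;> field_simp
  partials_α p hp := (hasPartials_comp_z (H.hasDerivAt_α hp.2)).congr_right (by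
    have := H.α_ne _ hp.2
    congr 3
    rw [logDerivInv]
    field_simp
    ring)
  partials_μ p hp := hasPartials_comp_z (H.hasDerivAt_logDerivInv hp.2)
  partials_P p hp := hasPartials_comp_base
    ((H.smooth_log_h.pd H.isOpen_base 0).differentiableAt_of_isOpen H.isOpen_base hp.1)
  partials_Q p hp := (hasPartials_comp_base
    ((H.smooth_log_h.pd H.isOpen_base 1).differentiableAt_of_isOpen H.isOpen_base hp.1)).congr_right
      (by rw [pd_comm H.smooth_log_h H.isOpen_base hp.1 0 1])
  partials_l p hp := hasPartials_comp_base
    (H.smooth_l.differentiableAt_of_isOpen H.isOpen_base hp.1)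
  partials_n p hp := (hasPartials_comp_base
    (H.smooth_n.differentiableAt_of_isOpen H.isOpen_base hp.1)).congr_right
      (by rw [H.curl _ hp.1])
  partials_lx p hp := hasPartials_comp_base
    ((H.smooth_l.pd H.isOpen_base 0).differentiableAt_of_isOpen H.isOpen_base hp.1)
  partials_ly p hp := (hasPartials_comp_base
    ((H.smooth_l.pd H.isOpen_base 1).differentiableAt_of_isOpen H.isOpen_base hp.1)).congr_right
      (by rw [pd_comm H.smooth_l H.isOpen_base hp.1 0 1])
  partials_ny p hp := (hasPartials_comp_base
    ((H.smooth_n.pd H.isOpen_base 1).differentiableAt_of_isOpen H.isOpen_base hp.1)).congr_right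
      (by
        have hd := H.smooth_h.differentiableAt_of_isOpen H.isOpen_base hp.1
        have hl := (H.smooth_l.pd H.isOpen_base 1).differentiableAt_of_isOpen H.isOpen_base hp.1
        have hne := (H.h_pos _ hp.1).ne'
        have he : pd 0 n =ᶠ[nhds (base p)] fun q => pd 1 l q + h q ^ 2 := by
          filter_upwards [H.isOpen_base.mem_nhds hp.1] with q hq
          exact H.curl q hq
        rw [pd_comm H.smooth_n H.isOpen_base hp.1 0 1, he.pd_eq, pd_add _ hl (hd.fun_pow 2),
          pd_pow _ 2 hd, H.pd_log_h hp.1]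
        congr 2
        field_simp
        simp
        ring)

theorem theta3_apply (p X : Coord 4) : theta3 β l n p X
    = 1 / β (p 2) * (X 3 - l (base p) * X 0 - n (base p) * X 1) := by
  simp [theta3, dcoord]

theorem calabiMetric_apply (p X Y : Coord 4) : calabiMetric A β h l n p X Y
    = Real.exp (-A (p 2)) * h (base p) ^ 2 * (X 0 * Y 0 + X 1 * Y 1)
      + theta3 β l n p X * theta3 β l n p Y + X 2 * Y 2 := by
  simp [calabiMetric, gSigma, tensor, theta4, dcoord]
  ring

theorem metricMatrix_eq (H : IsCalabiAnsatz U V α A β h l n) {p : Coord 4}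
    (hp : p ∈ domain U V) : metricMatrix (calabiMetric A β h l n) p = H.data.metric p := by
  ext i j
  rw [metricMatrix, Matrix.of_apply, calabiMetric_apply, theta3_apply, theta3_apply,
    H.one_div_β hp.2]
  fin_cases i <;> fin_cases j <;> simp [CalabiData.metric, data] <;> ring

theorem scalarCurvature_eq (H : IsCalabiAnsatz U V α A β h l n) {p : Coord 4}
    (hp : p ∈ domain U V) : scalarCurvature (calabiMetric A β h l n) p =
        2 * (-(laplacian (fun q => Real.log (h q)) (base p)
                * Real.exp (A (p 2)) / (h (base p)) ^ 2)
          - 2 * (α (p 2)) ^ 2 + 2 * deriv α (p 2)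
          + deriv (deriv β) (p 2) / β (p 2)
          - 2 * (deriv β (p 2) / β (p 2)) ^ 2) := by
  have hβ := H.β_ne hp.2
  have hα := H.α_ne _ hp.2
  have hh := (H.h_pos _ hp.1).ne'
  -- With `μ` as the only unknown beside `α`, both sides involve the same `2αμ - μ' - μ²`.
  have hμ : deriv α (p 2) = α (p 2) * logDerivInv α (p 2) + α (p 2) ^ 2 := by
    rw [logDerivInv]
    field_simp
    ring
  rw [H.data.scalarCurvature_eq (fun q hq => H.metricMatrix_eq hq) hp, H.deriv_deriv_β hp.2,
    (H.hasDerivAt_β hp.2).deriv, hμ]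
  simp only [CalabiData.horizontalRicci, CalabiData.verticalRicci, data, laplacian,
    Fin.sum_univ_two, Real.exp_neg]
  field_simp
  ring

end IsCalabiAnsatz

/-! ### Exterior derivatives and Nijenhuis tensors -/

section General

variable {n : ℕ} {M : Set (Coord n)} {g : BilinField n} {J : EndField n}

theorem extDeriv_fun_smul_form {k : ℕ} {f : Coord n → ℝ} {Ω : Coord n → Form n k} {p : Coord n}
    (hf : DifferentiableAt ℝ f p) (hΩ : DifferentiableAt ℝ Ω p) :
    extDeriv (fun q => f q • Ω q) p = wedge (fderiv ℝ f p) (Ω p) + f p • extDeriv Ω p := by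
  rw [extDeriv, (hf.hasFDerivAt.fun_smul hΩ.hasFDerivAt).fderiv,
    ContinuousAlternatingMap.alternatizeUncurryFin_add,
    ContinuousAlternatingMap.alternatizeUncurryFin_smul]
  exact add_comm _ _

theorem form_two_ext {η₁ η₂ : Form n 2} (h : ∀ X Y, η₁ ![X, Y] = η₂ ![X, Y]) : η₁ = η₂ := by
  ext v
  have hv : v = ![v 0, v 1] := by
    ext i
    fin_cases i <;> rfl
  rw [hv]
  exact h _ _

/-- All derivatives of `X` and `Y` cancel because `J² = -1`, so integrability becomes an algebraic
condition on `J` and its first derivative at the point. -/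
theorem nijenhuis_eq {X Y : Coord n → Coord n} {p : Coord n} (hJ : DifferentiableAt ℝ J p)
    (hX : DifferentiableAt ℝ X p) (hY : DifferentiableAt ℝ Y p) (hsq : ∀ v, J p (J p v) = -v) :
    nijenhuis J X Y p = fderiv ℝ J p (J p (X p)) (Y p) - fderiv ℝ J p (J p (Y p)) (X p)
      + J p (fderiv ℝ J p (Y p) (X p)) - J p (fderiv ℝ J p (X p) (Y p)) := by
  simp only [nijenhuis, VectorField.lieBracket, fderiv_clm_apply hJ hX, fderiv_clm_apply hJ hY,
    add_apply, ContinuousLinearMap.comp_apply, ContinuousLinearMap.flip_apply, map_sub, map_add,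
    hsq]
  abel

theorem fderiv_end_apply {p : Coord n} (hJ : DifferentiableAt ℝ J p) (v X : Coord n)
    (i : Fin n) :
    fderiv ℝ J p v X i = ∑ k, v k * pd k (fun q => J q X i) p := by
  rw [← fderiv_apply_eq_sum]
  have h1 : HasFDerivAt (fun q => J q X i)
      ((ContinuousLinearMap.proj i).comp ((fderiv ℝ J p).flip X)) p := by
    have h2 : HasFDerivAt (fun q => J q X) ((fderiv ℝ J p).flip X) p := by
      simpa using hJ.hasFDerivAt.clm_apply (hasFDerivAt_const X p)
    exact hasFDerivAt_pi'.1 h2 i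
  rw [h1.fderiv]
  simp

theorem pd_mul_sub_sub {f u v : Coord n → ℝ} {p : Coord n} (hf : DifferentiableAt ℝ f p)
    (hu : DifferentiableAt ℝ u p) (hv : DifferentiableAt ℝ v p) (i : Fin n) (a b c d : ℝ) :
    pd i (fun q => a * (f q * (b - u q * c - v q * d))) p
      = a * (pd i f p * (b - u p * c - v p * d) - f p * (pd i u p * c + pd i v p * d)) := by
  simp (disch := fun_prop (disch := assumption)) only [pd_mul, pd_sub, pd_const]
  ring

theorem pd_neg_add_sub {f u v : Coord n → ℝ} {p : Coord n} (hf : DifferentiableAt ℝ f p)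
    (hu : DifferentiableAt ℝ u p) (hv : DifferentiableAt ℝ v p) (i : Fin n) (a b c d : ℝ) :
    pd i (fun q => -(a * f q * b) + v q * c - u q * d) p
      = -(a * pd i f p * b) + pd i v p * c - pd i u p * d := by
  simp (disch := fun_prop (disch := assumption)) only [pd_mul, pd_sub, pd_add, pd_neg, pd_const]
  ring

theorem isRiemannianMetricOn_exp_smul (hg : IsRiemannianMetricOn g M) {φ : Coord n → ℝ}
    (hφ : ContDiffOn ℝ ∞ φ M) : IsRiemannianMetricOn (fun q => Real.exp (φ q) • g q) M where
  smooth := contDiffOn_clm_apply.2 fun X => contDiffOn_clm_apply.2 fun Y =>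
    hφ.exp.mul ((hg.smooth.clm_apply contDiffOn_const).clm_apply contDiffOn_const)
  symm p hp X Y := by
    simp [hg.symm p hp X Y]
  pos p hp X hX := by
    simpa using mul_pos (Real.exp_pos _) (hg.pos p hp X hX)

theorem isHermitianOn_exp_smul (hg : IsHermitianOn g J M) {φ : Coord n → ℝ}
    (hφ : ContDiffOn ℝ ∞ φ M) : IsHermitianOn (fun q => Real.exp (φ q) • g q) J M where
  metric := isRiemannianMetricOn_exp_smul hg.metric hφ
  smooth := hg.smooth
  sq := hg.sq
  orthogonal p hp X Y := by
    simp [hg.orthogonal p hp X Y]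
  integrable := hg.integrable

/-- A Hermitian manifold with Kähler form `Ω` is conformal to a Kähler one if `dΩ = -dφ ∧ Ω`. -/
theorem isKahlerOn_exp_smul (hM : IsOpen M) (hg : IsHermitianOn g J M)
    {Ω : Coord n → Form n 2} (hΩ : IsKahlerFormOn g J Ω M) (hdiff : ∀ p ∈ M, DifferentiableAt ℝ Ω p)
    {φ : Coord n → ℝ} (hφ : ContDiffOn ℝ ∞ φ M)
    (hd : ∀ p ∈ M, extDeriv Ω p = -wedge (fderiv ℝ φ p) (Ω p)) :
    IsKahlerOn (fun q => Real.exp (φ q) • g q) J M := by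
  refine ⟨isHermitianOn_exp_smul hg hφ, fun q => Real.exp (φ q) • Ω q, ?_, ?_⟩
  · intro p hp X Y
    simp [hΩ p hp X Y]
  · intro p hp
    have hφp := hφ.differentiableAt_of_isOpen hM hp
    rw [extDeriv_fun_smul_form hφp.exp (hdiff p hp), hd p hp, hφp.hasFDerivAt.exp.fderiv]
    ext v
    simp only [ContinuousAlternatingMap.add_apply, ContinuousAlternatingMap.smul_apply,
      ContinuousAlternatingMap.neg_apply, wedge_apply_two, smul_apply, smul_eq_mul]
    change _ = (0 : ℝ)
    ring

end General

/-! ### The metric and the two Hermitian structures -/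

namespace IsCalabiAnsatz

variable {U : Set (Coord 2)} {V : Set ℝ} {α A β : ℝ → ℝ} {h l n : Coord 2 → ℝ}

theorem contDiffOn_comp_base {f : Coord 2 → ℝ} (hf : ContDiffOn ℝ ∞ f U) :
    ContDiffOn ℝ ∞ (fun p : Coord 4 => f (base p)) (domain U V) :=
  hf.comp contDiff_base.contDiffOn fun _ hp => hp.1

theorem contDiffOn_comp_z {f : ℝ → ℝ} (hf : ContDiffOn ℝ ∞ f V) :
    ContDiffOn ℝ ∞ (fun p : Coord 4 => f (p 2)) (domain U V) :=
  hf.comp (contDiff_apply ℝ ℝ (2 : Fin 4)).contDiffOn fun _ hp => hp.2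

theorem contDiffOn_theta3 (H : IsCalabiAnsatz U V α A β h l n) :
    ContDiffOn ℝ ∞ (theta3 β l n) (domain U V) := by
  have hl := contDiffOn_comp_base (V := V) H.smooth_l
  have hn := contDiffOn_comp_base (V := V) H.smooth_n
  have hu : ContDiffOn ℝ ∞ (fun p : Coord 4 => 1 / β (p 2)) (domain U V) :=
    contDiffOn_const.div (contDiffOn_comp_z H.smooth_β) fun p hp => H.β_ne hp.2
  exact hu.smul ((contDiffOn_const.sub (hl.smul contDiffOn_const)).sub (hn.smul contDiffOn_const))

theorem contDiffOn_theta3_apply (H : IsCalabiAnsatz U V α A β h l n) (X : Coord 4) :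
    ContDiffOn ℝ ∞ (fun p => theta3 β l n p X) (domain U V) :=
  H.contDiffOn_theta3.clm_apply contDiffOn_const

theorem isRiemannianMetricOn (H : IsCalabiAnsatz U V α A β h l n) :
    IsRiemannianMetricOn (calabiMetric A β h l n) (domain U V) where
  smooth := by
    refine contDiffOn_clm_apply.2 fun X => contDiffOn_clm_apply.2 fun Y => ?_
    simp only [calabiMetric_apply]
    have hh := contDiffOn_comp_base (V := V) H.smooth_h
    have hA := contDiffOn_comp_z (U := U) H.smooth_A
    have hX := H.contDiffOn_theta3_apply X
    have hY := H.contDiffOn_theta3_apply Y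
    exact (((hA.neg.exp.mul (hh.pow 2)).mul contDiffOn_const).add (hX.mul hY)).add contDiffOn_const
  symm p _ X Y := by
    simp only [calabiMetric_apply]
    ring
  pos p hp X hX := by
    rw [calabiMetric_apply]
    have hc : 0 < Real.exp (-A (p 2)) * h (base p) ^ 2 :=
      mul_pos (Real.exp_pos _) (pow_pos (H.h_pos _ hp.1) 2)
    have hnonneg : 0 ≤ Real.exp (-A (p 2)) * h (base p) ^ 2 * (X 0 * X 0 + X 1 * X 1) :=
      mul_nonneg hc.le (add_nonneg (mul_self_nonneg _) (mul_self_nonneg _))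
    -- If the sum of three nonnegative terms vanishes, so does each; once `X 0 = X 1 = 0`, the
    -- vanishing of `θ₃(X)` gives `X 3 = 0`.
    refine lt_of_le_of_ne (add_nonneg (add_nonneg hnonneg (mul_self_nonneg _))
      (mul_self_nonneg _)) fun h0 => hX ?_
    have hθ := mul_self_nonneg (theta3 β l n p X)
    have h2 : X 2 = 0 := mul_self_eq_zero.1 (by linarith [mul_self_nonneg (X 2)])
    have hθ0 : theta3 β l n p X = 0 := mul_self_eq_zero.1 (by linarith [mul_self_nonneg (X 2)])
    have h01 : X 0 * X 0 + X 1 * X 1 = 0 := by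
      have : Real.exp (-A (p 2)) * h (base p) ^ 2 * (X 0 * X 0 + X 1 * X 1) = 0 := by
        linarith [mul_self_nonneg (X 2)]
      exact (mul_eq_zero.1 this).resolve_left hc.ne'
    have hX0 : X 0 = 0 := mul_self_eq_zero.1
      (by linarith [mul_self_nonneg (X 0), mul_self_nonneg (X 1)])
    have hX1 : X 1 = 0 := mul_self_eq_zero.1
      (by linarith [mul_self_nonneg (X 0), mul_self_nonneg (X 1)])
    have hX3 : X 3 = 0 := by
      rw [theta3_apply, hX0, hX1] at hθ0
      simpa [H.β_ne hp.2] using hθ0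
    ext i
    fin_cases i <;> assumption

/-- The almost complex structure with `dx ∘ J = -dy` and `θ₄ ∘ J = ε θ₃`. -/
def complexStructure (ε : ℝ) (β : ℝ → ℝ) (l n : Coord 2 → ℝ) : EndField 4 := fun p =>
  ContinuousLinearMap.pi ![-dcoord 1, dcoord 0, ε • theta3 β l n p,
    -(ε * β (p 2)) • dcoord 2 + n (base p) • dcoord 0 - l (base p) • dcoord 1]

theorem complexStructure_apply (ε : ℝ) (p X : Coord 4) :
    complexStructure ε β l n p X = ![-X 1, X 0, ε * theta3 β l n p X,
      -(ε * β (p 2) * X 2) + n (base p) * X 0 - l (base p) * X 1] := by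
  ext i
  fin_cases i <;> simp [complexStructure, dcoord]

/-- The coefficients of the `∂t` component of `J` are chosen for this: `θ₃ ∘ J = -εθ₄` complements
`θ₄ ∘ J = εθ₃`. Orthogonality, the Kähler form and Ricci invariance all rest on these two relations.
-/
theorem theta3_complexStructure (H : IsCalabiAnsatz U V α A β h l n) (ε : ℝ) {p : Coord 4}
    (hp : p ∈ domain U V) (X : Coord 4) :
    theta3 β l n p (complexStructure ε β l n p X) = -(ε * X 2) := by
  have := H.β_ne hp.2
  rw [theta3_apply, complexStructure_apply]
  simp
  field_simp

theorem contDiffOn_complexStructure (H : IsCalabiAnsatz U V α A β h l n) (ε : ℝ) :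
    ContDiffOn ℝ ∞ (complexStructure ε β l n) (domain U V) := by
  refine contDiffOn_clm_apply.2 fun X => ?_
  simp only [complexStructure_apply]
  have hl := contDiffOn_comp_base (V := V) H.smooth_l
  have hn := contDiffOn_comp_base (V := V) H.smooth_n
  have hβ := contDiffOn_comp_z (U := U) H.smooth_β
  refine contDiffOn_pi.2 fun i => ?_
  fin_cases i
  · exact contDiffOn_const
  · exact contDiffOn_const
  · exact contDiffOn_const.mul (H.contDiffOn_theta3_apply X)
  · exact (((contDiffOn_const.mul hβ).mul contDiffOn_const).neg.add
      (hn.mul contDiffOn_const)).sub (hl.mul contDiffOn_const)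

theorem complexStructure_sq (H : IsCalabiAnsatz U V α A β h l n) {ε : ℝ} (hε : ε ^ 2 = 1)
    {p : Coord 4} (hp : p ∈ domain U V) (X : Coord 4) :
    complexStructure ε β l n p (complexStructure ε β l n p X) = -X := by
  have hβ := H.β_ne hp.2
  rw [complexStructure_apply, H.theta3_complexStructure ε hp, complexStructure_apply]
  ext i
  fin_cases i
  · simp
  · simp
  · simp
    linear_combination X 2 * hε
  · simp [theta3_apply]
    field_simp
    linear_combination -(X 3 - l (base p) * X 0 - n (base p) * X 1) * hε

theorem nijenhuis_complexStructure (H : IsCalabiAnsatz U V α A β h l n) {ε : ℝ}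
    (hε : ε ^ 2 = 1) {X Y : Coord 4 → Coord 4} {p : Coord 4} (hp : p ∈ domain U V)
    (hX : DifferentiableAt ℝ X p) (hY : DifferentiableAt ℝ Y p) :
    nijenhuis (complexStructure ε β l n) X Y p = 0 := by
  have hJ : DifferentiableAt ℝ (complexStructure ε β l n) p :=
    ((H.contDiffOn_complexStructure ε).contDiffAt
      (H.isOpen_domain.mem_nhds hp)).differentiableAt (by simp)
  have hβ := H.β_ne hp.2
  obtain ⟨dβ, pβ⟩ := hasPartials_comp_z (H.hasDerivAt_β hp.2)
  obtain ⟨du, pu⟩ := hasPartials_comp_z ((H.hasDerivAt_β hp.2).fun_inv hβ)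
  obtain ⟨dl, pl⟩ := H.data.partials_l p hp
  obtain ⟨dn, pn⟩ := H.data.partials_n p hp
  simp only [data] at dl pl dn pn
  -- The first two rows of `J` are constant, so its derivative has only `∂z` and `∂t` components.
  -- The mixed term `n_x` is already replaced by `l_y + h²`.
  have hD : ∀ v Z : Coord 4, fderiv ℝ (complexStructure ε β l n) p v Z
      = ![0, 0, ε / β (p 2) * (logDerivInv α (p 2) * v 2
            * (Z 3 - l (base p) * Z 0 - n (base p) * Z 1)
          - (pd 0 l (base p) * v 0 + pd 1 l (base p) * v 1) * Z 0
          - ((pd 1 l (base p) + h (base p) ^ 2) * v 0 + pd 1 n (base p) * v 1) * Z 1),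
        ε * logDerivInv α (p 2) * β (p 2) * v 2 * Z 2
          + ((pd 1 l (base p) + h (base p) ^ 2) * v 0 + pd 1 n (base p) * v 1) * Z 0
          - (pd 0 l (base p) * v 0 + pd 1 l (base p) * v 1) * Z 1] := by
    intro v Z
    ext i
    rw [fderiv_end_apply hJ]
    simp only [complexStructure_apply, theta3_apply, one_div]
    fin_cases i <;> simp [Fin.sum_univ_four, pd_const]
    · simp only [pd_mul_sub_sub du dl dn, pu, pl, pn]
      simp
      field_simp
      ring
    · simp only [pd_neg_add_sub dβ dl dn, pβ, pl, pn]
      simp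
      ring

  rw [nijenhuis_eq hJ hX hY (H.complexStructure_sq hε hp)]
  simp only [hD, complexStructure_apply, theta3_apply]
  -- The cancellation uses `ε² = 1`; splitting into the two signs leaves plain ring identities.
  have hε' : ε = 1 ∨ ε = -1 := mul_self_eq_one_iff.1 (by rw [← sq, hε])
  ext i
  rcases hε' with rfl | rfl <;> fin_cases i <;> simp <;> field_simp <;> ring

theorem isHermitianOn (H : IsCalabiAnsatz U V α A β h l n) {ε : ℝ} (hε : ε ^ 2 = 1) :
    IsHermitianOn (calabiMetric A β h l n) (complexStructure ε β l n) (domain U V) where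
  metric := H.isRiemannianMetricOn
  smooth := H.contDiffOn_complexStructure ε
  sq _ hp := H.complexStructure_sq hε hp
  orthogonal p hp X Y := by
    rw [calabiMetric_apply, calabiMetric_apply, H.theta3_complexStructure ε hp,
      H.theta3_complexStructure ε hp, complexStructure_apply, complexStructure_apply]
    simp
    linear_combination (X 2 * Y 2 + theta3 β l n p X * theta3 β l n p Y) * hε
  integrable _ _ hX hY p hp := H.nijenhuis_complexStructure hε hp
    ((hX.contDiffAt (H.isOpen_domain.mem_nhds hp)).differentiableAt (by simp))
    ((hY.contDiffAt (H.isOpen_domain.mem_nhds hp)).differentiableAt (by simp))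

/-! ### Kähler forms, the Kähler structure and the Lee form -/

/-- The 2-form `e^{-A} ω_Σ + ε θ₃ ∧ θ₄`. -/
def kahlerForm (ε : ℝ) (A β : ℝ → ℝ) (h l n : Coord 2 → ℝ) (p : Coord 4) : Form 4 2 :=
  Real.exp (-A (p 2)) • omegaSigma h p + ε • wedgeOne (theta3 β l n p) (theta4 p)

theorem kahlerForm_apply (ε : ℝ) (p : Coord 4) (v : Fin 2 → Coord 4) :
    kahlerForm ε A β h l n p v
      = Real.exp (-A (p 2)) * h (base p) ^ 2 * (v 0 0 * v 1 1 - v 1 0 * v 0 1)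
        + ε * (theta3 β l n p (v 0) * v 1 2 - theta3 β l n p (v 1) * v 0 2) := by
  simp [kahlerForm, omegaSigma, wedgeOne_apply, theta4, dcoord]
  ring

theorem omega_eq : omega A β h l n = kahlerForm 1 A β h l n := by
  funext p
  simp [omega, kahlerForm]

theorem omegaBar_eq : omegaBar A β h l n = kahlerForm (-1) A β h l n := by
  funext p
  ext v
  simp [omegaBar, kahlerForm, wedgeOne_apply]
  ring

theorem isKahlerFormOn (H : IsCalabiAnsatz U V α A β h l n) (ε : ℝ) :
    IsKahlerFormOn (calabiMetric A β h l n) (complexStructure ε β l n)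
      (kahlerForm ε A β h l n) (domain U V) := by
  intro p hp X Y
  rw [kahlerForm_apply, calabiMetric_apply, H.theta3_complexStructure ε hp,
    complexStructure_apply]
  simp
  ring

/-- With constant coordinate 2-forms, the exterior derivative only differentiates the scalar
coefficients. -/
theorem kahlerForm_eq_sum (ε : ℝ) : kahlerForm ε A β h l n = fun p =>
    (Real.exp (-A (p 2)) * h (base p) ^ 2) • wedgeOne (dcoord 0) (dcoord 1)
      + (ε * (β (p 2))⁻¹) • wedgeOne (dcoord 3) (dcoord 2)
      + (-(ε * ((β (p 2))⁻¹ * l (base p)))) • wedgeOne (dcoord 0) (dcoord 2)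
      + (-(ε * ((β (p 2))⁻¹ * n (base p)))) • wedgeOne (dcoord 1) (dcoord 2) := by
  funext p
  ext v
  simp [kahlerForm, wedgeOne_apply, theta3_apply, omegaSigma, theta4, dcoord]
  ring

/-- The summand `E ω_Σ` contributes `-α θ₄ ∧ E ω_Σ`, and `ε dθ₃ ∧ θ₄` contributes `ε` times the same
3-form. As `θ₄ ∧ θ₃ ∧ θ₄ = 0`, the full form may replace `E ω_Σ`. -/
theorem differentiableAt_extDeriv_kahlerForm (H : IsCalabiAnsatz U V α A β h l n) (ε : ℝ)
    {p : Coord 4} (hp : p ∈ domain U V) :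
    DifferentiableAt ℝ (kahlerForm ε A β h l n) p ∧
      extDeriv (kahlerForm ε A β h l n) p
        = wedge (-((1 + ε) * α (p 2)) • theta4 p) (kahlerForm ε A β h l n p) := by
  have hβ := H.β_ne hp.2
  have pu := hasPartials_comp_z ((H.hasDerivAt_β hp.2).fun_inv hβ)
  -- This makes the two contributions comparable: the curvature of `θ₃` has coefficient `1/β`, while
  -- `dE = -αE dz`.
  have hinv : (β (p 2))⁻¹ = α (p 2) * Real.exp (-A (p 2)) := by
    rw [← H.one_div_β hp.2, one_div]
  have pE := H.data.partials_E p hp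
  have pH := H.data.partials_H p hp
  have pl := H.data.partials_l p hp
  have pn := H.data.partials_n p hp
  simp only [data] at pE pH pl pn
  have dEH := pE.1.fun_mul pH.1
  have dul := pu.1.fun_mul pl.1
  have dun := pu.1.fun_mul pn.1
  have d1 := dEH.smul_const (wedgeOne (dcoord 0) (dcoord 1) : Form 4 2)
  have d2 := (pu.1.const_mul ε).smul_const (wedgeOne (dcoord 3) (dcoord 2) : Form 4 2)
  have d3 := (dul.const_mul ε).fun_neg.smul_const (wedgeOne (dcoord 0) (dcoord 2) : Form 4 2)
  have d4 := (dun.const_mul ε).fun_neg.smul_const (wedgeOne (dcoord 1) (dcoord 2) : Form 4 2)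
  refine ⟨by rw [kahlerForm_eq_sum]; exact ((d1.fun_add d2).fun_add d3).fun_add d4, ?_⟩
  ext v
  conv_lhs => rw [kahlerForm_eq_sum]
  rw [extDeriv_fun_add ((d1.fun_add d2).fun_add d3) d4, extDeriv_fun_add (d1.fun_add d2) d3,
    extDeriv_fun_add d1 d2, extDeriv_smul_const dEH, extDeriv_smul_const (pu.1.const_mul ε),
    extDeriv_smul_const (dul.const_mul ε).fun_neg, extDeriv_smul_const (dun.const_mul ε).fun_neg]
  have hdiff : ∀ w : Coord 4,
      fderiv ℝ (fun q : Coord 4 => Real.exp (-A (q 2)) * h (base q) ^ 2) p w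
        = Real.exp (-A (p 2)) * h (base p) ^ 2
          * (2 * pd 0 (fun q => Real.log (h q)) (base p) * w 0
            + 2 * pd 1 (fun q => Real.log (h q)) (base p) * w 1 - α (p 2) * w 2) ∧
      fderiv ℝ (fun q : Coord 4 => ε * (β (q 2))⁻¹) p w
        = ε * (β (p 2))⁻¹ * logDerivInv α (p 2) * w 2 ∧
      fderiv ℝ (fun q : Coord 4 => -(ε * ((β (q 2))⁻¹ * l (base q)))) p w
        = -(ε * (β (p 2))⁻¹ * (logDerivInv α (p 2) * l (base p) * w 2
          + pd 0 l (base p) * w 0 + pd 1 l (base p) * w 1)) ∧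
      fderiv ℝ (fun q : Coord 4 => -(ε * ((β (q 2))⁻¹ * n (base q)))) p w
        = -(ε * (β (p 2))⁻¹ * (logDerivInv α (p 2) * n (base p) * w 2
          + (pd 1 l (base p) + h (base p) ^ 2) * w 0 + pd 1 n (base p) * w 1)) := by
    intro w
    simp only [fderiv_apply_eq_sum, Fin.sum_univ_four, pd_neg]
    refine ⟨?_, ?_, ?_, ?_⟩
    · simp only [pd_mul _ pE.1 pH.1, pE.2, pH.2]
      simp
      ring
    · simp only [pd_mul _ (differentiableAt_const ε) pu.1, pd_const, pu.2]
      simp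
      field_simp
    · simp only [pd_mul _ (differentiableAt_const ε) dul, pd_mul _ pu.1 pl.1, pd_const, pu.2, pl.2]
      simp
      field_simp
      ring
    · simp only [pd_mul _ (differentiableAt_const ε) dun, pd_mul _ pu.1 pn.1, pd_const, pu.2, pn.2]
      simp
      field_simp
      ring
  simp only [ContinuousAlternatingMap.add_apply, wedge_apply_two, fun w => (hdiff w).1,
    fun w => (hdiff w).2.1, fun w => (hdiff w).2.2.1, fun w => (hdiff w).2.2.2, wedgeOne_apply,
    kahlerForm_apply, theta3_apply, one_div, hinv]
  simp [theta4, dcoord]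
  ring

/-- In the frame `∂x + l ∂t`, `∂y + n ∂t`, `∂z`, `∂t` the form pairs the first two vectors and the
last two. Evaluating on one vector together with the opposite pair leaves a nonzero multiple of the
covector on that vector. -/
theorem eq_zero_of_wedge_kahlerForm_eq_zero (H : IsCalabiAnsatz U V α A β h l n) {ε : ℝ}
    (hε : ε ≠ 0) {p : Coord 4} (hp : p ∈ domain U V) {δ : Coord 4 →L[ℝ] ℝ}
    (hδ : wedge δ (kahlerForm ε A β h l n p) = 0) : δ = 0 := by
  have hβ := H.β_ne hp.2
  have hh := (H.h_pos _ hp.1).ne'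
  have hE := Real.exp_ne_zero (-A (p 2))
  have key : ∀ X Y Z : Coord 4, δ X * kahlerForm ε A β h l n p ![Y, Z]
      - δ Y * kahlerForm ε A β h l n p ![X, Z] + δ Z * kahlerForm ε A β h l n p ![X, Y] = 0 := by
    intro X Y Z
    have := congrArg (fun w => w ![X, Y, Z]) hδ
    rw [wedge_apply_two] at this
    exact this
  simp only [kahlerForm_apply, theta3_apply] at key
  have h0 := key ![1, 0, 0, l (base p)] ![0, 0, 0, 1] ![0, 0, 1, 0]
  have h1 := key ![0, 1, 0, n (base p)] ![0, 0, 0, 1] ![0, 0, 1, 0]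
  have h2 := key ![0, 0, 1, 0] ![1, 0, 0, l (base p)] ![0, 1, 0, n (base p)]
  have h3 := key ![0, 0, 0, 1] ![1, 0, 0, l (base p)] ![0, 1, 0, n (base p)]
  simp [hβ, hε, hh, hE] at h0 h1 h2 h3
  ext X
  have hX : X = X 0 • ![1, 0, 0, l (base p)] + X 1 • ![0, 1, 0, n (base p)]
      + X 2 • ![0, 0, 1, 0] + (X 3 - l (base p) * X 0 - n (base p) * X 1) • ![0, 0, 0, 1] := by
    ext i
    fin_cases i <;> simp
    ring
  rw [hX]
  simp only [map_add, map_smul, h0, h1, h2, h3]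
  simp

theorem extDeriv_kahlerForm_one (H : IsCalabiAnsatz U V α A β h l n) {p : Coord 4}
    (hp : p ∈ domain U V) : extDeriv (kahlerForm 1 A β h l n) p
      = (2 : ℝ) • wedge (-(α (p 2) • theta4 p)) (kahlerForm 1 A β h l n p) := by
  rw [(H.differentiableAt_extDeriv_kahlerForm 1 hp).2, ← wedge_smul_left]
  congr 1
  module

theorem isKahlerOn (H : IsCalabiAnsatz U V α A β h l n) :
    IsKahlerOn (calabiMetric A β h l n) (complexStructure (-1) β l n) (domain U V) := by
  refine ⟨H.isHermitianOn (by norm_num), _, H.isKahlerFormOn _, fun p hp => ?_⟩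
  rw [(H.differentiableAt_extDeriv_kahlerForm (-1) hp).2]
  simpa using wedge_smul_left (theta4 p) 0 (kahlerForm (-1) A β h l n p)

theorem isLocallyConformallyKahlerOn (H : IsCalabiAnsatz U V α A β h l n) :
    IsLocallyConformallyKahlerOn (calabiMetric A β h l n) (complexStructure 1 β l n)
      (domain U V) := by
  have hJ := H.isHermitianOn (ε := 1) (by norm_num)
  -- Since `dΩ = -2 dA ∧ Ω`, the factor `e^{2A}` closes the form on all of the domain, so no
  -- shrinking is needed.
  refine ⟨hJ, fun p hp => ⟨domain U V, H.isOpen_domain, hp, subset_rfl, fun q => 2 * A (q 2),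
    contDiffOn_const.mul (contDiffOn_comp_z H.smooth_A), ?_⟩⟩
  refine isKahlerOn_exp_smul H.isOpen_domain hJ (H.isKahlerFormOn _)
    (fun q hq => (H.differentiableAt_extDeriv_kahlerForm 1 hq).1)
    (contDiffOn_const.mul (contDiffOn_comp_z H.smooth_A)) fun q hq => ?_
  have hA : fderiv ℝ (fun q : Coord 4 => 2 * A (q 2)) q = (2 * α (q 2)) • theta4 q := by
    ext X
    have := hasPartials_comp_z ((H.hasDerivAt_A _ hq.2).const_mul 2)
    rw [fderiv_apply_eq_sum]
    simp [this.2, Fin.sum_univ_four, theta4, dcoord]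
    ring
  rw [H.extDeriv_kahlerForm_one hq, hA, ← wedge_smul_left, ← neg_one_smul ℝ (wedge _ _),
    ← wedge_smul_left]
  congr 1
  module

theorem isLeeFormOn_iff (H : IsCalabiAnsatz U V α A β h l n) (θ : Coord 4 → Coord 4 →L[ℝ] ℝ) :
    IsLeeFormOn (calabiMetric A β h l n) (complexStructure 1 β l n) θ (domain U V) ↔
      ∀ p ∈ domain U V, θ p = -(α (p 2) • theta4 p) := by
  have hΩ := H.isKahlerFormOn 1
  constructor
  · rintro ⟨-, Ω, hform, hd⟩ p hp
    -- The form in the definition is existential, but `g` and `J` determine it on the domain.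
    have heq : ∀ q ∈ domain U V, Ω q = kahlerForm 1 A β h l n q := fun q hq =>
      form_two_ext fun X Y => by rw [hform q hq, hΩ q hq]
    have hev : Ω =ᶠ[nhds p] kahlerForm 1 A β h l n := by
      filter_upwards [H.isOpen_domain.mem_nhds hp] with q hq using heq q hq
    have hdp := hd p hp
    rw [hev.extDeriv_eq, heq p hp, H.extDeriv_kahlerForm_one hp] at hdp
    have hw := smul_right_injective _ (two_ne_zero (α := ℝ)) hdp
    refine sub_eq_zero.1 (H.eq_zero_of_wedge_kahlerForm_eq_zero one_ne_zero hp ?_)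
    rw [wedge_sub_left, ← hw, sub_self]
  · intro hθ
    refine ⟨?_, _, hΩ, fun p hp => ?_⟩
    · exact ((contDiffOn_comp_z H.smooth_α).smul contDiffOn_const).neg.congr hθ
    · rw [H.extDeriv_kahlerForm_one hp, hθ p hp]

/-! ### Invariance of the Ricci tensor -/

theorem ricci_eq (H : IsCalabiAnsatz U V α A β h l n) {p : Coord 4} (hp : p ∈ domain U V)
    (X Y : Coord 4) : ricci (calabiMetric A β h l n) p X Y
      = H.data.horizontalRicci p * (X 0 * Y 0 + X 1 * Y 1)
        + H.data.verticalRicci p * (theta3 β l n p X * theta3 β l n p Y + X 2 * Y 2) := by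
  simp only [ricci, H.data.ricciComp_eq (fun q hq => H.metricMatrix_eq hq) hp, Fin.sum_univ_four,
    theta3_apply, H.one_div_β hp.2]
  -- The two eigenvalues stay opaque; only the block shape of the Ricci matrix matters.
  generalize hv : H.data.verticalRicci p = v
  generalize hw : H.data.horizontalRicci p = w
  simp only [CalabiData.ricciMatrix, hv, hw, Fin.isValue, Matrix.of_apply, Matrix.cons_val]
  simp only [data]
  ring

theorem hasInvariantRicciOn (H : IsCalabiAnsatz U V α A β h l n) {ε : ℝ} (hε : ε ^ 2 = 1) :
    HasInvariantRicciOn (calabiMetric A β h l n) (complexStructure ε β l n) (domain U V) := by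
  intro p hp X Y
  rw [H.ricci_eq hp, H.ricci_eq hp, H.theta3_complexStructure ε hp, H.theta3_complexStructure ε hp,
    complexStructure_apply, complexStructure_apply]
  simp
  linear_combination
    H.data.verticalRicci p * (X 2 * Y 2 + theta3 β l n p X * theta3 β l n p Y) * hε

end IsCalabiAnsatz

end Calabi

end

theorem theorem1 (U : Set (Calabi.Coord 2)) (hU : IsOpen U) (V : Set ℝ) (hV : IsOpen V)
    (α A β : ℝ → ℝ) (hα : ContDiffOn ℝ ∞ α V) (hα0 : ∀ z ∈ V, α z ≠ 0)
    (hA : ∀ z ∈ V, HasDerivAt A (α z) z) (hβ : ∀ z ∈ V, β z * α z = Real.exp (A z))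
    (h l₂ n₂ : Calabi.Coord 2 → ℝ) (hh : ContDiffOn ℝ ∞ h U) (hpos : ∀ q ∈ U, 0 < h q)
    (hl : ContDiffOn ℝ ∞ l₂ U) (hn : ContDiffOn ℝ ∞ n₂ U)
    (hd : ∀ q ∈ U, extDeriv (fun r => Calabi.asForm (Calabi.connectionForm l₂ n₂ r)) q
      = Calabi.areaForm h q) :
    Calabi.IsRiemannianMetricOn (Calabi.calabiMetric A β h l₂ n₂) (Calabi.domain U V) ∧
    (∃ Jbar : Calabi.EndField 4,
      Calabi.IsKahlerOn (Calabi.calabiMetric A β h l₂ n₂) Jbar (Calabi.domain U V) ∧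
      Calabi.IsKahlerFormOn (Calabi.calabiMetric A β h l₂ n₂) Jbar
        (Calabi.omegaBar A β h l₂ n₂) (Calabi.domain U V)) ∧
    (∃ J : Calabi.EndField 4,
      Calabi.IsHermitianOn (Calabi.calabiMetric A β h l₂ n₂) J (Calabi.domain U V) ∧
      Calabi.IsKahlerFormOn (Calabi.calabiMetric A β h l₂ n₂) J
        (Calabi.omega A β h l₂ n₂) (Calabi.domain U V) ∧
      Calabi.HasInvariantRicciOn (Calabi.calabiMetric A β h l₂ n₂) J (Calabi.domain U V) ∧
      Calabi.IsLocallyConformallyKahlerOn (Calabi.calabiMetric A β h l₂ n₂) J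
        (Calabi.domain U V) ∧
      (∀ θ : Calabi.Coord 4 → Calabi.Coord 4 →L[ℝ] ℝ,
        Calabi.IsLeeFormOn (Calabi.calabiMetric A β h l₂ n₂) J θ (Calabi.domain U V) ↔
          ∀ p ∈ Calabi.domain U V, θ p = -(α (p 2) • Calabi.theta4 p))) ∧
    (∀ p ∈ Calabi.domain U V,
      Calabi.scalarCurvature (Calabi.calabiMetric A β h l₂ n₂) p =
        2 * (-(Calabi.laplacian (fun q => Real.log (h q)) (Calabi.base p)
                * Real.exp (A (p 2)) / (h (Calabi.base p)) ^ 2)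
          - 2 * (α (p 2)) ^ 2 + 2 * deriv α (p 2)
          + deriv (deriv β) (p 2) / β (p 2)
          - 2 * (deriv β (p 2) / β (p 2)) ^ 2)) := by
  have H : Calabi.IsCalabiAnsatz U V α A β h l₂ n₂ :=
    ⟨hU, hV, hα, hα0, hA, hβ, hh, hpos, hl, hn,
      fun q hq => Calabi.pd_sub_pd_eq_of_extDeriv hU hl hn hq (hd q hq)⟩
  refine ⟨H.isRiemannianMetricOn, ⟨_, H.isKahlerOn, ?_⟩, ⟨_, H.isHermitianOn (one_pow 2), ?_,
    H.hasInvariantRicciOn (one_pow 2), H.isLocallyConformallyKahlerOn, H.isLeeFormOn_iff⟩,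
    fun p hp => H.scalarCurvature_eq hp⟩
  · rw [Calabi.IsCalabiAnsatz.omegaBar_eq]
    exact H.isKahlerFormOn _
  · rw [Calabi.IsCalabiAnsatz.omega_eq]
    exact H.isKahlerFormOn 1
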